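/- Let $\mathbb{K}$ be a field of characteristic $0$, let $n\ge 1$, and let $e_1,\dots,e_n$ be the standard basis of $V=\mathbb{K}^n$. Put $$\det\nolimits_n=\sum_{\sigma\in\mathfrak{S}_n}\operatorname{sgn}(\sigma)\,e_{\sigma(1)}\otimes\cdots\otimes e_{\sigma(n)},\qquad \operatorname{perm}_n=\sum_{\sigma\in\mathfrak{S}_n}e_{\sigma(1)}\otimes\cdots\otimes e_{\sigma(n)}$$ in $V^{\otimes n}$. For $T\in V^{\otimes n}$ let the tensor rank $\mathbf{R}(T)$ be the least $k$ such that $T$ is a sum of $k$ tensors of the form $v_1\otimes\cdots\otimes v_n$, and let the border rank $\underline{\mathbf{R}}(T)$ be the least $k$ such that $T$ lies in the Zariski closure of $\{S\in V^{\otimes n} : \mathbf{R}(S)\le k\}$, that is, every polynomial function on $V^{\otimes n}$ with coefficients in $\mathbb{K}$ that vanishes on this set vanishes at $T$. Then $$\underline{\mathbf{R}}(\det\nolimits_n)\ \ge\ \frac{n^{n-1}}{(n-1)!}.$$ Moreover, for every $n\ge 3$, $$\mathbf{R}(\operatorname{perm}_n)\le 2^{n-1}<\frac{n^{n-1}}{(n-1)!}\le\underline{\mathbf{R}}(\det\nolimits_n)\le\mathbf{R}(\det\nolimits_n),$$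 so that $\mathbf{R}(\operatorname{perm}_n)<\mathbf{R}(\det_n)$. -/

import Mathlib

open scoped TensorProduct Nat

noncomputable section

namespace TensorRank

variable {K : Type*} [Field K]

/-- The Zariski closure of a subset `Z` of a vector space `W`: the common zeros of all polynomial
functions on `W` that vanish on `Z`. A polynomial function is a polynomial expression, with
coefficients in `K`, in linear forms on `W`. -/
def zariskiClosure {W : Type*} [AddCommGroup W] [Module K W] (Z : Set W) : Set W :=
  {w | ∀ p : MvPolynomial (Module.Dual K W) K,
    (∀ z ∈ Z, MvPolynomial.eval (fun f : Module.Dual K W => f z) p = 0) →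
      MvPolynomial.eval (fun f : Module.Dual K W => f w) p = 0}

variable {d : ℕ} {V : Fin d → Type*} [∀ j, AddCommGroup (V j)] [∀ j, Module K (V j)]

/-- `T` is a sum of `k` tensors of the form `v₁ ⊗ ⋯ ⊗ v_d`. -/
def IsSumOfDecomposables (T : ⨂[K] j, V j) (k : ℕ) : Prop :=
  ∃ v : Fin k → (j : Fin d) → V j, T = ∑ i, PiTensorProduct.tprod K (v i)

/-- The tensor rank of `T`: the least `k` such that `T` is a sum of `k` decomposable tensors
(such a `k` exists when `d` is positive, see `exists_isSumOfDecomposables`). -/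
def tensorRank (T : ⨂[K] j, V j) : ℕ :=
  sInf {k | IsSumOfDecomposables T k}

/-- The border rank of `T`: the least `k` such that `T` lies in the Zariski closure of the set of
tensors of rank at most `k`. -/
def borderRank (T : ⨂[K] j, V j) : ℕ :=
  sInf {k | T ∈ zariskiClosure (K := K) {S : ⨂[K] j, V j | tensorRank S ≤ k}}

/-- The minimum in the definition of the tensor rank is over a nonempty set. -/
theorem exists_isSumOfDecomposables (hd : 1 ≤ d) (T : ⨂[K] j, V j) :
    ∃ k, IsSumOfDecomposables T k := by
  induction T using PiTensorProduct.induction_on with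
  | smul_tprod r f =>
    refine ⟨1, fun _ => Function.update f ⟨0, hd⟩ (r • f ⟨0, hd⟩), ?_⟩
    simp
  | add x y hx hy =>
    obtain ⟨k, v, rfl⟩ := hx
    obtain ⟨l, w, rfl⟩ := hy
    exact ⟨k + l, Fin.append v w, by simp [Fin.sum_univ_add]⟩

/-- The minimum in the definition of the border rank is over a nonempty set. -/
theorem exists_mem_zariskiClosure (T : ⨂[K] j, V j) :
    ∃ k, T ∈ zariskiClosure (K := K) {S : ⨂[K] j, V j | tensorRank S ≤ k} :=
  ⟨tensorRank T, fun _ hp => hp T (le_refl (tensorRank T))⟩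

variable (K)

/-- The determinant tensor `∑_σ sgn(σ) e_{σ(1)} ⊗ ⋯ ⊗ e_{σ(n)}` in `(Kⁿ)^{⊗ n}`. -/
def detTensor (n : ℕ) : ⨂[K] _j : Fin n, (Fin n → K) :=
  ∑ σ : Equiv.Perm (Fin n), ((Equiv.Perm.sign σ : ℤ) : K) •
    PiTensorProduct.tprod K (fun j : Fin n => (Pi.single (σ j) 1 : Fin n → K))

/-- The permanent tensor `∑_σ e_{σ(1)} ⊗ ⋯ ⊗ e_{σ(n)}` in `(Kⁿ)^{⊗ n}`. -/
def permTensor (n : ℕ) : ⨂[K] _j : Fin n, (Fin n → K) :=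
  ∑ σ : Equiv.Perm (Fin n),
    PiTensorProduct.tprod K (fun j : Fin n => (Pi.single (σ j) 1 : Fin n → K))

end TensorRank

end

/-!
Regard an element of `⋀(K^{n+1} ⊗ V)`, `V = K^n`, as a system of fermions on an array with rows
`0, …, n`. A tensor in `V^{⊗ n}` acts on it by contracting the rows `1, …, n` with its factors; this
operator, restricted to a weight space (prescribed numbers of particles in the rows), is the
flattening.

For the determinant, following the flattening by the creation of a full row `0` gives the product of
the operators moving a particle from row `p` to row `0`, `p = 1, …, n`. Each of these is the raising
operator of an `sl₂`-triple, so it is injective where row `p` holds more particles than row `0`.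
Starting from an empty row `0` and `n, …, 1` particles in the rows `1, …, n`, this holds at every
stage, so the flattening of the determinant is injective on a space of dimension `∏ k, n.choose k`.

The flattening of a decomposable tensor has rank at most `∏ k, (n - 1).choose (k - 1)`, because only
those configurations survive in which each row `p ≥ 1` contains the single site not killed by its
functional. As injectivity is a Zariski open condition, the border rank of the determinant is at
least the quotient `n^n / n!`. The bound for the permanent is Glynn's formula.
-/

noncomputable section

namespace TensorRank

open Module

section FermionicOperators

variable {K M : Type*} [CommRing K] [AddCommGroup M] [Module K M]

variable (K) in
/-- Left exterior multiplication by a vector (a creation operator on the Fock space `⋀M`). -/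
def wedge : M →ₗ[K] End K (ExteriorAlgebra K M) :=
  (Algebra.lmul K (ExteriorAlgebra K M)).toLinearMap ∘ₗ ExteriorAlgebra.ι K

/-- Contraction with a functional (an annihilation operator on the Fock space `⋀M`). -/
def contract : Dual K M →ₗ[K] End K (ExteriorAlgebra K M) :=
  CliffordAlgebra.contractLeft

theorem wedge_apply (m : M) (x : ExteriorAlgebra K M) :
    wedge K m x = ExteriorAlgebra.ι K m * x :=
  rfl

theorem contract_wedge_apply (d : Dual K M) (m : M) (x : ExteriorAlgebra K M) :
    contract d (wedge K m x) = d m • x - wedge K m (contract d x) :=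
  CliffordAlgebra.contractLeft_ι_mul d m x

theorem contract_apply_one (d : Dual K M) : contract d (1 : ExteriorAlgebra K M) = 0 :=
  CliffordAlgebra.contractLeft_one _ d

theorem wedge_wedge_apply (m m' : M) (x : ExteriorAlgebra K M) :
    wedge K m (wedge K m' x) = -wedge K m' (wedge K m x) := by
  rw [eq_neg_iff_add_eq_zero]
  simp only [wedge_apply, ← mul_assoc, ← add_mul, ExteriorAlgebra.ι_add_mul_swap, zero_mul]

theorem contract_contract_apply (d d' : Dual K M) (x : ExteriorAlgebra K M) :
    contract d (contract d' x) = -contract d' (contract d x) :=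
  CliffordAlgebra.contractLeft_comm d d' x

theorem lie_wedge_mul_contract_wedge (m m' : M) (d : Dual K M) :
    ⁅wedge K m * contract d, wedge K m'⁆ = d m' • wedge K m := by
  refine LinearMap.ext fun x => ?_
  simp only [Ring.lie_def, LinearMap.sub_apply, End.mul_apply, LinearMap.smul_apply,
    contract_wedge_apply, map_sub, map_smul, wedge_wedge_apply m' m]
  abel

theorem wedge_ιMulti (n : ℕ) (m : Fin (n + 1) → M) :
    ExteriorAlgebra.ιMulti K (n + 1) m =
      wedge K (m 0) (ExteriorAlgebra.ιMulti K n fun i => m i.succ) :=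
  ExteriorAlgebra.ιMulti_succ_apply m

theorem contract_ιMulti_eq_zero {n : ℕ} {d : Dual K M} {m : Fin n → M} (h : ∀ i, d (m i) = 0) :
    contract d (ExteriorAlgebra.ιMulti K n m) = 0 := by
  induction n with
  | zero => simpa using contract_apply_one d
  | succ n ih =>
    rw [wedge_ιMulti, contract_wedge_apply, h 0, ih fun i => h i.succ, zero_smul, map_zero,
      sub_zero]

theorem apply_wedge_apply_of_lie_eq {D : End K (ExteriorAlgebra K M)} {m m' : M}
    (h : ⁅D, wedge K m⁆ = wedge K m') (x : ExteriorAlgebra K M) :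
    D (wedge K m x) = wedge K m' x + wedge K m (D x) :=
  sub_eq_iff_eq_add.1 (LinearMap.congr_fun h x)

theorem eq_of_lie_wedge_eq {f : M → M} {D D' : End K (ExteriorAlgebra K M)} (h1 : D 1 = 0)
    (h1' : D' 1 = 0) (h : ∀ m, ⁅D, wedge K m⁆ = wedge K (f m))
    (h' : ∀ m, ⁅D', wedge K m⁆ = wedge K (f m)) : D = D' := by
  refine LinearMap.ext fun x => ?_
  induction x using CliffordAlgebra.left_induction with
  | algebraMap r => rw [Algebra.algebraMap_eq_smul_one, map_smul, map_smul, h1, h1']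
  | add x y hx hy => rw [map_add, map_add, hx, hy]
  | ι_mul x m hx =>
    change D (wedge K m x) = D' (wedge K m x)
    rw [apply_wedge_apply_of_lie_eq (h m), apply_wedge_apply_of_lie_eq (h' m), hx]

section Derivation

attribute [local instance] LieRing.ofAssociativeRing

variable [Module.Free K M] [Module.Finite K M]

variable (K M) in
theorem exists_lieHom_lie_wedge : ∃ D : End K M →ₗ⁅K⁆ End K (ExteriorAlgebra K M),
    ∀ f, D f 1 = 0 ∧ ∀ m, ⁅D f, wedge K m⁆ = wedge K (f m) := by
  let b := Free.chooseBasis K M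
  let D : End K M →ₗ[K] End K (ExteriorAlgebra K M) :=
    ∑ i, (LinearMap.mulRight K (contract (b.coord i))) ∘ₗ wedge K ∘ₗ LinearMap.applyₗ (b i)
  have hD (f) : D f = ∑ i, wedge K (f (b i)) * contract (b.coord i) := by simp [D]
  have one (f) : D f 1 = 0 := by simp [hD, contract_apply_one]
  have lie (f m) : ⁅D f, wedge K m⁆ = wedge K (f m) := by
    simp only [hD, sum_lie, lie_wedge_mul_contract_wedge, Basis.coord_apply]
    simp only [← map_smul, ← map_sum, b.sum_repr]
  refine ⟨{ D with map_lie' := fun {f g} => ?_ }, fun f => ⟨one f, lie f⟩⟩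
  refine eq_of_lie_wedge_eq (one _) ?_ (lie _) fun m => ?_
  · simp [Ring.lie_def, one]
  · change ⁅⁅D f, D g⁆, wedge K m⁆ = _
    rw [lie_lie, lie, lie, lie, lie, ← map_sub]
    rfl

variable (K M) in
/-- The extension of an endomorphism of `M` to a derivation of `⋀M`, as a homomorphism of Lie
algebras. -/
def derivationExt : End K M →ₗ⁅K⁆ End K (ExteriorAlgebra K M) :=
  (exists_lieHom_lie_wedge K M).choose

theorem derivationExt_apply_one (f : End K M) : derivationExt K M f 1 = 0 :=
  ((exists_lieHom_lie_wedge K M).choose_spec f).1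

theorem lie_derivationExt_wedge (f : End K M) (m : M) :
    ⁅derivationExt K M f, wedge K m⁆ = wedge K (f m) :=
  ((exists_lieHom_lie_wedge K M).choose_spec f).2 m

theorem derivationExt_wedge_apply (f : End K M) (m : M) (x : ExteriorAlgebra K M) :
    derivationExt K M f (wedge K m x) = wedge K (f m) x + wedge K m (derivationExt K M f x) :=
  apply_wedge_apply_of_lie_eq (lie_derivationExt_wedge f m) x

theorem derivationExt_ιMulti {n : ℕ} {f : End K M} {c : Fin n → K} {m : Fin n → M}
    (h : ∀ i, f (m i) = c i • m i) :
    derivationExt K M f (ExteriorAlgebra.ιMulti K n m) =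
      (∑ i, c i) • ExteriorAlgebra.ιMulti K n m := by
  induction n with
  | zero => simpa using derivationExt_apply_one f
  | succ n ih =>
    rw [wedge_ιMulti, derivationExt_wedge_apply, h 0, ih fun i => h i.succ, map_smul, map_smul,
      LinearMap.smul_apply, ← add_smul, Fin.sum_univ_succ]

end Derivation

end FermionicOperators

section Rows

attribute [local instance] LieRing.ofAssociativeRing

instance finiteDimensional_exteriorAlgebra (K M : Type*) [Field K] [AddCommGroup M] [Module K M]
    [FiniteDimensional K M] : FiniteDimensional K (ExteriorAlgebra K M) :=
  .of_basis (finBasis K M).ExteriorAlgebra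

variable {R K V : Type*} [DecidableEq R]

section CommRing

variable [CommRing K] [AddCommGroup V] [Module K V]

variable (K V) in
/-- The endomorphism of `R → V` moving the entry of row `q` to row `p`: a matrix unit. -/
def rowTransfer (p q : R) : End K (R → V) :=
  LinearMap.single K (fun _ => V) p ∘ₗ LinearMap.proj q

theorem rowTransfer_mul_rowTransfer (p q r s : R) :
    rowTransfer K V p q * rowTransfer K V r s = if q = r then rowTransfer K V p s else 0 := by
  refine LinearMap.ext fun m => ?_
  rcases eq_or_ne q r with rfl | h <;> simp [rowTransfer, *]

variable [Finite R] [Module.Free K V] [Module.Finite K V]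

variable (K V) in
/-- The operator on `⋀(R → V)` moving a particle from row `q` to row `p`; for `p = q` it counts the
particles in row `p`. -/
def rowMove (p q : R) : End K (ExteriorAlgebra K (R → V)) :=
  derivationExt K (R → V) (rowTransfer K V p q)

theorem lie_rowMove_rowMove (p q r s : R) :
    ⁅rowMove K V p q, rowMove K V r s⁆ =
      (if q = r then rowMove K V p s else 0) - if s = p then rowMove K V r q else 0 := by
  rw [rowMove, rowMove, ← LieHom.map_lie, Ring.lie_def, rowTransfer_mul_rowTransfer,
    rowTransfer_mul_rowTransfer, map_sub, apply_ite (derivationExt _ _),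
    apply_ite (derivationExt _ _), map_zero]
  rfl

variable (K V) in
/-- The elements of `⋀(R → V)` with `w p` particles in each row `p`. -/
def weightSpace (w : R → ℤ) : Submodule K (ExteriorAlgebra K (R → V)) :=
  ⨅ p, (rowMove K V p p).eigenspace (w p : K)

theorem mem_weightSpace {w : R → ℤ} {x : ExteriorAlgebra K (R → V)} :
    x ∈ weightSpace K V w ↔ ∀ p, rowMove K V p p x = (w p : K) • x := by
  simp only [weightSpace, Submodule.mem_iInf, End.mem_eigenspace_iff]

theorem rowMove_mem_weightSpace {w : R → ℤ} {x : ExteriorAlgebra K (R → V)}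
    (hx : x ∈ weightSpace K V w) (p q : R) :
    rowMove K V p q x ∈ weightSpace K V (w + Pi.single p 1 - Pi.single q 1) := by
  rw [mem_weightSpace] at hx ⊢
  intro r
  have h := LinearMap.congr_fun (lie_rowMove_rowMove (K := K) (V := V) r r p q) x
  rw [Ring.lie_def, LinearMap.sub_apply, End.mul_apply, End.mul_apply, hx, map_smul,
    sub_eq_iff_eq_add] at h
  rw [h]
  rcases eq_or_ne r p with rfl | hp <;> rcases eq_or_ne q r with rfl | hq <;>
    simp [*, add_smul, sub_smul, Ne.symm]
  all_goals abel

end CommRing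

variable [Finite R] [Field K] [CharZero K] [AddCommGroup V] [Module K V] [FiniteDimensional K V]

theorem eq_zero_of_rowMove_eq_zero {w : R → ℤ} {x : ExteriorAlgebra K (R → V)}
    (hx : x ∈ weightSpace K V w) {p q : R} (hpq : w p < w q) (h : rowMove K V p q x = 0) :
    x = 0 := by
  -- Otherwise `x` is a primitive vector of negative weight in a finite-dimensional `sl₂`-module.
  by_contra hne
  have hweight : (rowMove K V p p - rowMove K V q q) x = ((w p - w q : ℤ) : K) • x := by
    rw [LinearMap.sub_apply, mem_weightSpace.1 hx, mem_weightSpace.1 hx, Int.cast_sub, sub_smul]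
  have hpq' : p ≠ q := fun e => hpq.ne (congrArg w e)
  have triple : IsSl2Triple (rowMove K V p p - rowMove K V q q) (rowMove K V p q)
      (rowMove K V q p) := by
    refine ⟨fun h0 => ?_, ?_, ?_, ?_⟩
    · rw [h0, LinearMap.zero_apply] at hweight
      exact smul_ne_zero (Int.cast_ne_zero.2 (sub_neg.2 hpq).ne) hne hweight.symm
    all_goals simp only [sub_lie, lie_rowMove_rowMove, if_true, if_neg hpq', if_neg hpq'.symm]
    all_goals abel
  have primitive : triple.HasPrimitiveVectorWith x ((w p - w q : ℤ) : K) := ⟨hne, hweight, h⟩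
  obtain ⟨k, hk⟩ := primitive.exists_nat
  have : w p - w q = k := by exact_mod_cast hk
  omega

theorem eq_zero_of_prod_rowMove_eq_zero {n : ℕ} {o : R} {r : Fin n → R}
    (hr : Function.Injective r) {w : R → ℤ} (hw : ∀ i, w o + (i.rev : ℕ) < w (r i))
    {x : ExteriorAlgebra K (R → V)} (hx : x ∈ weightSpace K V w)
    (h : (List.ofFn fun i => rowMove K V o (r i)).prod x = 0) : x = 0 := by
  induction n generalizing w x with
  | zero => simpa using h
  | succ n ih =>
    rw [List.ofFn_succ', List.concat_eq_append, List.prod_append, List.prod_singleton,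
      End.mul_apply] at h
    have hlast : w o < w (r (Fin.last n)) := by simpa using hw (Fin.last n)
    refine eq_zero_of_rowMove_eq_zero hx hlast ?_
    refine ih (hr.comp (Fin.castSucc_injective n)) (fun i => ?_)
      (rowMove_mem_weightSpace hx o (r (Fin.last n))) h
    have hi : r i.castSucc ≠ r (Fin.last n) := hr.ne (Fin.castSucc_lt_last i).ne
    have hi' := hw i.castSucc
    rw [Fin.rev_castSucc, Fin.val_succ] at hi'
    have ho : r i.castSucc ≠ o := fun e => by rw [e] at hi'; omega
    have ho' : o ≠ r (Fin.last n) := fun e => hlast.ne (congrArg w e)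
    simp only [Function.comp_apply, Pi.add_apply, Pi.sub_apply, Pi.single_apply, if_true,
      if_neg hi, if_neg ho, if_neg ho']
    push_cast at hi'
    omega

end Rows

section ExteriorBasis

variable {K M I : Type*} [CommRing K] [AddCommGroup M] [Module K M] [LinearOrder I]
  (b : Basis I K M) (S : Finset I)

theorem exteriorAlgebra_basis_eq_ιMulti :
    b.ExteriorAlgebra S = ExteriorAlgebra.ιMulti K S.card fun i => b (S.orderEmbOfFin rfl i) := by
  rw [ExteriorAlgebra.basis_apply]
  rfl

theorem contract_exteriorAlgebra_basis_eq_zero {d : Dual K M} (h : ∀ i ∈ S, d (b i) = 0) :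
    contract d (b.ExteriorAlgebra S) = 0 := by
  rw [exteriorAlgebra_basis_eq_ιMulti]
  exact contract_ιMulti_eq_zero fun i => h _ (S.orderEmbOfFin_mem rfl i)

theorem derivationExt_exteriorAlgebra_basis [Module.Free K M] [Module.Finite K M] {f : End K M}
    {c : I → K} (h : ∀ i, f (b i) = c i • b i) :
    derivationExt K M f (b.ExteriorAlgebra S) = (∑ i ∈ S, c i) • b.ExteriorAlgebra S := by
  have hsum : ∑ i, c (S.orderEmbOfFin rfl i) = ∑ i ∈ S, c i :=
    ((S.orderIsoOfFin rfl).toEquiv.sum_comp fun i => c i).trans (S.sum_coe_sort c)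
  rw [exteriorAlgebra_basis_eq_ιMulti, derivationExt_ιMulti fun i => h _, hsum]

end ExteriorBasis

section RowBasis

variable {R C K V : Type*}

section Cells

variable [Fintype R] [Fintype C] [DecidableEq R] [DecidableEq C]

/-- A set of cells of an array, listed by rows. -/
def rowsEquiv : Finset (R ×ₗ C) ≃ (R → Finset C) where
  toFun S p := {j | toLex (p, j) ∈ S}
  invFun S := {x | (ofLex x).2 ∈ S (ofLex x).1}
  left_inv S := by ext x; simp
  right_inv S := by ext p j; simp

theorem mem_rowsEquiv_symm {S : R → Finset C} {x : R ×ₗ C} :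
    x ∈ rowsEquiv.symm S ↔ (ofLex x).2 ∈ S (ofLex x).1 := by
  simp [rowsEquiv]

theorem card_filter_fst_eq_rowsEquiv_symm (S : R → Finset C) (p : R) :
    (Finset.card {x ∈ rowsEquiv.symm S | (ofLex x).1 = p}) = (S p).card := by
  refine Finset.card_nbij' (fun x => (ofLex x).2) (fun j => toLex (p, j)) ?_ ?_ ?_ fun j _ => rfl
  · intro x hx
    obtain ⟨hS, rfl⟩ := Finset.mem_filter.1 hx
    exact mem_rowsEquiv_symm.1 hS
  · intro j hj
    simpa [mem_rowsEquiv_symm] using hj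
  · intro x hx
    obtain ⟨-, rfl⟩ := Finset.mem_filter.1 hx
    rfl

end Cells

variable [LinearOrder R] [Fintype R] [CommRing K] [AddCommGroup V] [Module K V]
  (b : R → Basis C K V)

/-- The basis of `R → V` given by a basis of each row, ordered lexicographically. -/
def arrayBasis : Basis (R ×ₗ C) K (R → V) :=
  (Pi.basis b).reindex ((Equiv.sigmaEquivProd R C).trans toLex)

theorem arrayBasis_apply (x : R ×ₗ C) :
    arrayBasis b x = Pi.single (ofLex x).1 (b (ofLex x).1 (ofLex x).2) := by
  simp [arrayBasis]

variable [LinearOrder C] [Fintype C]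

/-- The basis of `⋀(R → V)` given by a basis of each row; its elements are indexed by the set of
occupied sites in each row. -/
def fockBasis : Basis (R → Finset C) K (ExteriorAlgebra K (R → V)) :=
  (arrayBasis b).ExteriorAlgebra.reindex rowsEquiv

theorem contract_proj_fockBasis_eq_zero {p : R} {d : Dual K V} {S : R → Finset C}
    (h : ∀ j ∈ S p, d (b p j) = 0) :
    contract (d ∘ₗ LinearMap.proj p) (fockBasis b S) = 0 := by
  rw [fockBasis, Basis.reindex_apply]
  refine contract_exteriorAlgebra_basis_eq_zero _ _ fun x hx => ?_
  rw [mem_rowsEquiv_symm] at hx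
  rw [arrayBasis_apply]
  rcases eq_or_ne p (ofLex x).1 with rfl | hp
  · simpa using h _ hx
  · simp [hp]

theorem rowMove_self_fockBasis [Module.Free K V] [Module.Finite K V] (p : R) (S : R → Finset C) :
    rowMove K V p p (fockBasis b S) = ((S p).card : K) • fockBasis b S := by
  have hdiag (x : R ×ₗ C) : rowTransfer K V p p (arrayBasis b x) =
      (if (ofLex x).1 = p then (1 : K) else 0) • arrayBasis b x := by
    rw [arrayBasis_apply]
    split_ifs with h <;> simp [rowTransfer, h, Ne.symm]
  have hcard : ∑ x ∈ rowsEquiv.symm S, (if (ofLex x).1 = p then (1 : K) else 0) = (S p).card := by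
    rw [Finset.sum_boole, card_filter_fst_eq_rowsEquiv_symm]
  rw [fockBasis, Basis.reindex_apply, rowMove, derivationExt_exteriorAlgebra_basis _ _ hdiag, hcard]

end RowBasis

theorem iInf_eigenspace_eq_span {K X ι P : Type*} [Field K] [AddCommGroup X] [Module K X]
    (b : Basis ι K X) {T : P → End K X} {μ : P → ι → K} (h : ∀ p i, T p (b i) = μ p i • b i)
    (ν : P → K) :
    ⨅ p, (T p).eigenspace (ν p) = Submodule.span K (b '' {i | ∀ p, μ p i = ν p}) := by
  apply le_antisymm
  · intro x hx
    rw [Basis.mem_span_image]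
    intro i hi p
    have hx' : T p x = ν p • x := by simpa using (Submodule.mem_iInf _).1 hx p
    have hcoord : b.coord i ∘ₗ T p = μ p i • b.coord i :=
      b.ext fun j => by rcases eq_or_ne j i with rfl | hj <;> simp [*]
    have hμν : (μ p i - ν p) * b.repr x i = 0 := by
      have := LinearMap.congr_fun hcoord x
      simp only [LinearMap.comp_apply, hx', map_smul, LinearMap.smul_apply, Basis.coord_apply,
        smul_eq_mul] at this
      rw [sub_mul, this, sub_self]
    exact sub_eq_zero.1 ((mul_eq_zero.1 hμν).resolve_right (Finsupp.mem_support_iff.1 hi))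
  · rw [Submodule.span_le]
    rintro _ ⟨i, hi, rfl⟩
    simp_all

section WeightSpace

variable {R C K V : Type*} [LinearOrder R] [LinearOrder C] [Fintype R] [Fintype C] [Field K]
  [CharZero K] [AddCommGroup V] [Module K V] [FiniteDimensional K V] (b : R → Basis C K V)

theorem weightSpace_eq_span (w : R → ℕ) :
    weightSpace K V (fun p => (w p : ℤ)) = Submodule.span K
      (fockBasis b '' (Fintype.piFinset fun p => Finset.univ.powersetCard (w p) :
        Finset (R → Finset C))) := by
  rw [weightSpace, iInf_eigenspace_eq_span (fockBasis b) (rowMove_self_fockBasis b)]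
  congr! 2
  ext S
  simp

theorem finrank_weightSpace (w : R → ℕ) :
    finrank K (weightSpace K V fun p => (w p : ℤ)) = ∏ p, (finrank K V).choose (w p) := by
  have b : R → Basis (Fin (finrank K V)) K V := fun _ => finBasis K V
  rw [weightSpace_eq_span b, Set.image_eq_range]
  refine (finrank_span_eq_card ((fockBasis b).linearIndependent.comp _
    Subtype.val_injective)).trans ?_
  change Fintype.card (Fintype.piFinset fun p => Finset.univ.powersetCard (w p)) = _
  simp only [Fintype.card_coe, Fintype.card_piFinset, Finset.card_powersetCard, Finset.card_univ,
    Fintype.card_fin]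

end WeightSpace

section Contraction

variable {K M : Type*} [CommRing K] [AddCommGroup M] [Module K M]

theorem prod_contract_apply_eq_zero {n : ℕ} {d : Fin n → Dual K M} {x : ExteriorAlgebra K M}
    {p : Fin n} (h : contract (d p) x = 0) : (List.ofFn fun i => contract (d i)).prod x = 0 := by
  induction n generalizing x with
  | zero => exact p.elim0
  | succ n ih =>
    rw [List.ofFn_succ', List.concat_eq_append, List.prod_append, List.prod_singleton,
      End.mul_apply]
    induction p using Fin.lastCases with
    | last => rw [h, map_zero]
    | cast p =>
      refine ih (p := p) ?_
      rw [contract_contract_apply, h, map_zero, neg_zero]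

theorem prod_wedge_mul_contract {n : ℕ} {m : Fin n → M} {d : Fin n → Dual K M}
    (h : ∀ i j, d i (m j) = 0) :
    (List.ofFn fun i => wedge K (m i) * contract (d i)).prod =
      (List.ofFn fun i => wedge K (m i)).reverse.prod *
        (List.ofFn fun i => contract (d i)).prod := by
  induction n with
  | zero => simp
  | succ n ih =>
    -- An operator `wedge * contract` has even degree, hence commutes with the other creations.
    have hcomm : Commute (wedge K (m 0) * contract (d 0))
        (List.ofFn fun i : Fin n => wedge K (m i.succ)).reverse.prod := by
      refine Commute.list_prod_right _ _ fun y hy => ?_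
      obtain ⟨i, rfl⟩ := (List.mem_ofFn' _ _).1 (List.mem_reverse.1 hy)
      refine sub_eq_zero.1 ((lie_wedge_mul_contract_wedge (m 0) (m i.succ) (d 0)).trans ?_)
      rw [h, zero_smul]
    simp only [List.ofFn_succ, List.prod_cons, List.reverse_cons, List.prod_append,
      List.prod_nil, mul_one, ih fun i j => h i.succ j.succ]
    rw [← mul_assoc, hcomm.eq]
    simp only [mul_assoc]

theorem prod_reverse_wedge {n : ℕ} (m : Fin n → M) :
    (List.ofFn fun i => wedge K (m i)).reverse.prod =
      Algebra.lmul K (ExteriorAlgebra K M)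
        (CliffordAlgebra.reverse (ExteriorAlgebra.ιMulti K n m)) := by
  induction n with
  | zero => simpa using (map_one (Algebra.lmul K (ExteriorAlgebra K M))).symm
  | succ n ih =>
    rw [wedge_ιMulti, wedge_apply, CliffordAlgebra.reverse.map_mul, map_mul, ← ih, List.ofFn_succ,
      List.reverse_cons, List.prod_append, List.prod_singleton]
    exact congrArg (_ * Algebra.lmul K _ ·) (CliffordAlgebra.reverse_ι (Q := 0) (m 0)).symm

theorem derivationExt_smulRight [Module.Free K M] [Module.Finite K M] (d : Dual K M) (m : M) :
    derivationExt K M (d.smulRight m) = wedge K m * contract d :=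
  eq_of_lie_wedge_eq (derivationExt_apply_one _) (by simp [contract_apply_one])
    (lie_derivationExt_wedge _) fun m' => by
      rw [lie_wedge_mul_contract_wedge, LinearMap.smulRight_apply, map_smul]

end Contraction

section RowContraction

variable {K V : Type*} [CommRing K] [AddCommGroup V] [Module K V]

variable (K V) in
/-- The product of the contractions of the rows `1, …, n` of an array with rows `0, …, n`, the
`p`-th of which is contracted with the `p`-th functional. -/
def rowContraction (n : ℕ) :
    MultilinearMap K (fun _ : Fin n => Dual K V) (End K (ExteriorAlgebra K (Fin (n + 1) → V))) :=
  (MultilinearMap.mkPiAlgebraFin K n _).compLinearMap fun p =>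
    contract ∘ₗ (LinearMap.proj p.succ : (Fin (n + 1) → V) →ₗ[K] V).dualMap

theorem rowContraction_apply {n : ℕ} (d : Fin n → Dual K V) :
    rowContraction K V n d = (List.ofFn fun p => contract (d p ∘ₗ LinearMap.proj p.succ)).prod :=
  MultilinearMap.mkPiAlgebraFin_apply (R := K) _

end RowContraction

theorem exists_basis_fin_succ_dual_apply_eq_zero {K V : Type*} [Field K] [AddCommGroup V]
    [Module K V] [FiniteDimensional K V] {N : ℕ} (hV : finrank K V = N + 1) {d : Dual K V}
    (hd : d ≠ 0) :
    ∃ b : Basis (Fin (N + 1)) K V, ∀ j, j ≠ 0 → d (b j) = 0 := by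
  obtain ⟨y, hy⟩ : ∃ y, d y ≠ 0 := by
    by_contra! h
    exact hd (LinearMap.ext h)
  have hker : finrank K (LinearMap.ker d) = N := by
    have := Dual.finrank_ker_add_one_of_ne_zero hd
    omega
  refine ⟨Basis.mkFinCons y (finBasisOfFinrankEq K _ hker) (fun c x hx hc => ?_) fun z =>
    ⟨-(d z / d y), ?_⟩, fun j hj => ?_⟩
  · have := congrArg d hc
    rw [map_add, map_smul, LinearMap.mem_ker.1 hx, add_zero, map_zero] at this
    exact (smul_eq_zero.1 this).resolve_right hy
  · simp [hy]
  · obtain ⟨i, rfl⟩ := Fin.exists_succ_eq.2 hj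
    simp

theorem finrank_map_rowContraction_le {K V : Type*} [Field K] [CharZero K] [AddCommGroup V]
    [Module K V] [FiniteDimensional K V] {n N : ℕ} (hV : finrank K V = N + 1) {w : Fin (n + 1) → ℕ}
    (hw : ∀ p : Fin n, 1 ≤ w p.succ) (d : Fin n → Dual K V) :
    finrank K ((weightSpace K V fun p => (w p : ℤ)).map (rowContraction K V n d)) ≤
      (N + 1).choose (w 0) * ∏ p : Fin n, N.choose (w p.succ - 1) := by
  classical
  by_cases hd : ∃ p, d p = 0
  · obtain ⟨p, hp⟩ := hd
    rw [MultilinearMap.map_coord_zero _ p hp, Submodule.map_zero, finrank_bot]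
    exact Nat.zero_le _
  push Not at hd
  choose b hb using fun p => exists_basis_fin_succ_dual_apply_eq_zero hV (hd p)
  let b' : Fin (n + 1) → Basis (Fin (N + 1)) K V := Fin.cons (finBasisOfFinrankEq K V hV) b
  let f S := rowContraction K V n d (fockBasis b' S)
  let t : Fin (n + 1) → Finset (Fin (N + 1)) := Fin.cons ∅ fun _ => {0}
  let s := Fintype.piFinset fun p => {A ∈ Finset.univ.powersetCard (w p) | t p ⊆ A}
  have hf {S} (hS : ∃ p : Fin n, 0 ∉ S p.succ) : f S = 0 := by
    obtain ⟨p, hp⟩ := hS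
    simp only [f, rowContraction_apply]
    refine prod_contract_apply_eq_zero (p := p) (contract_proj_fockBasis_eq_zero _ fun j hj => ?_)
    exact hb p j fun h => hp (h ▸ hj)
  have hspan : (weightSpace K V fun p => (w p : ℤ)).map (rowContraction K V n d) ≤
      Submodule.span K (s.image f : Set _) := by
    rw [weightSpace_eq_span b', Submodule.map_span_le]
    rintro _ ⟨S, hS, rfl⟩
    by_cases h : ∃ p : Fin n, 0 ∉ S p.succ
    · change f S ∈ _
      rw [hf h]
      exact Submodule.zero_mem _
    push Not at h
    refine Submodule.subset_span (Finset.mem_coe.2 (Finset.mem_image_of_mem f ?_))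
    rw [Finset.mem_coe, Fintype.mem_piFinset] at hS
    refine Fintype.mem_piFinset.2 fun p => Finset.mem_filter.2 ⟨hS p, ?_⟩
    induction p using Fin.cases <;> simp [t, h]
  have hcard : s.card = (N + 1).choose (w 0) * ∏ p : Fin n, N.choose (w p.succ - 1) := by
    rw [Fintype.card_piFinset, Fin.prod_univ_succ]
    congr 1
    · simp [t]
    · refine Finset.prod_congr rfl fun p _ => ?_
      rw [Finset.card_filter_powersetCard_subset _ _ _ (Finset.subset_univ _)] <;> simp [t, hw]
  exact (Submodule.finrank_mono hspan).trans
    ((finrank_span_finset_le_card _).trans (Finset.card_image_le.trans hcard.le))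

section KoszulFlattening

variable {K ι : Type*} [CommRing K] [Fintype ι] [DecidableEq ι]

variable (K ι) in
/-- The Koszul flattening of a tensor `T` in `(K^ι)^{⊗ n}`: the operator on `⋀(K^{n+1} ⊗ K^ι)`
contracting the rows `1, …, n` with the `n` factors of `T`, where `K^ι` is identified with its dual
by the dot product. Row `0` is left untouched. -/
def koszulFlattening (n : ℕ) :
    (⨂[K] _ : Fin n, (ι → K)) →ₗ[K] End K (ExteriorAlgebra K (Fin (n + 1) → ι → K)) :=
  PiTensorProduct.lift ((rowContraction K (ι → K) n).compLinearMap fun _ =>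
    (dotProductEquiv K ι).toLinearMap)

theorem koszulFlattening_tprod {n : ℕ} (v : Fin n → ι → K) :
    koszulFlattening K ι n (PiTensorProduct.tprod K v) =
      rowContraction K (ι → K) n fun p => dotProductEquiv K ι (v p) :=
  PiTensorProduct.lift.tprod v

theorem rowMove_eq_sum {R : Type*} [DecidableEq R] [Finite R] (p q : R) :
    rowMove K (ι → K) p q = ∑ j, wedge K (Pi.single p (Pi.single j 1 : ι → K)) *
      contract (dotProductEquiv K ι (Pi.single j 1) ∘ₗ LinearMap.proj q) := by
  have : rowTransfer K (ι → K) p q = ∑ j,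
      (dotProductEquiv K ι (Pi.single j 1) ∘ₗ LinearMap.proj q).smulRight
        (Pi.single p (Pi.single j 1 : ι → K)) := by
    refine LinearMap.ext fun m => ?_
    simp only [rowTransfer, LinearMap.comp_apply, LinearMap.proj_apply, LinearMap.sum_apply,
      LinearMap.smulRight_apply, dotProductEquiv_apply_apply, single_one_dotProduct]
    conv_lhs => rw [pi_eq_sum_univ' (m q), map_sum]
    simp only [map_smul, LinearMap.coe_single]
  rw [rowMove, this, map_sum]
  simp only [derivationExt_smulRight]

theorem prod_rowMove_eq_sum (n : ℕ) :
    (List.ofFn fun p : Fin n => rowMove K (ι → K) 0 p.succ).prod = ∑ r : Fin n → ι,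
      Algebra.lmul K _ (CliffordAlgebra.reverse (ExteriorAlgebra.ιMulti K n fun p =>
        (Pi.single 0 (Pi.single (r p) 1) : Fin (n + 1) → ι → K))) *
      koszulFlattening K ι n (PiTensorProduct.tprod K fun p => Pi.single (r p) 1) := by
  simp only [rowMove_eq_sum]
  rw [← MultilinearMap.mkPiAlgebraFin_apply (R := K), MultilinearMap.map_sum]
  refine Finset.sum_congr rfl fun r _ => ?_
  rw [MultilinearMap.mkPiAlgebraFin_apply, prod_wedge_mul_contract, prod_reverse_wedge,
    koszulFlattening_tprod, rowContraction_apply]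
  intro i j
  rw [LinearMap.comp_apply, LinearMap.proj_apply, Pi.single_eq_of_ne i.succ_ne_zero, map_zero]

end KoszulFlattening

theorem sum_perm_eq_sum_of_not_bijective {ι M : Type*} [Fintype ι] [DecidableEq ι]
    [AddCommMonoid M] (g : (ι → ι) → M) (hg : ∀ r, ¬ Function.Bijective r → g r = 0) :
    ∑ r, g r = ∑ σ : Equiv.Perm ι, g σ := by
  refine (Finset.sum_of_injOn (fun σ : Equiv.Perm ι => (σ : ι → ι))
    (fun σ _ τ _ h => DFunLike.coe_injective h) (by simp [Set.MapsTo]) (fun r _ hr => hg r ?_)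
    fun σ _ => rfl).symm
  exact fun hb => hr ⟨Equiv.ofBijective r hb, by simp, rfl⟩

theorem prod_rowMove_eq_koszulFlattening_detTensor {K : Type*} [Field K] (n : ℕ) :
    (List.ofFn fun p : Fin n => rowMove K (Fin n → K) 0 p.succ).prod =
      Algebra.lmul K _ (CliffordAlgebra.reverse (ExteriorAlgebra.ιMulti K n fun p =>
        (Pi.single 0 (Pi.single p 1) : Fin (n + 1) → Fin n → K))) *
      koszulFlattening K (Fin n) n (detTensor K n) := by
  let e (j : Fin n) : Fin (n + 1) → Fin n → K := Pi.single 0 (Pi.single j 1)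
  rw [prod_rowMove_eq_sum, sum_perm_eq_sum_of_not_bijective, detTensor, map_sum, Finset.mul_sum]
  · refine Finset.sum_congr rfl fun σ _ => ?_
    have hσ : ExteriorAlgebra.ιMulti K n (fun p => e (σ p)) =
        ((Equiv.Perm.sign σ : ℤ) : K) • ExteriorAlgebra.ιMulti K n e := by
      rw [Int.cast_smul_eq_zsmul]
      exact AlternatingMap.map_perm _ e σ
    rw [hσ, map_smul, map_smul, map_smul, smul_mul_assoc, mul_smul_comm]
  · intro r hr
    have hr' : ¬ Function.Injective fun p => e (r p) := fun h =>
      hr (Finite.injective_iff_bijective.1 (h.of_comp (f := e)))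
    rw [AlternatingMap.map_eq_zero_of_not_injective _ _ hr', map_zero, map_zero, zero_mul]

theorem eq_zero_of_koszulFlattening_detTensor_eq_zero {K : Type*} [Field K] [CharZero K] {n : ℕ}
    {w : Fin (n + 1) → ℤ} (hw : ∀ p : Fin n, w 0 + (p.rev : ℕ) < w p.succ)
    {x : ExteriorAlgebra K (Fin (n + 1) → Fin n → K)} (hx : x ∈ weightSpace K (Fin n → K) w)
    (h : koszulFlattening K (Fin n) n (detTensor K n) x = 0) : x = 0 := by
  refine eq_zero_of_prod_rowMove_eq_zero (Fin.succ_injective n) hw hx ?_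
  rw [prod_rowMove_eq_koszulFlattening_detTensor, End.mul_apply, h, map_zero]

theorem finrank_map_koszulFlattening_tprod_le {K ι : Type*} [Field K] [CharZero K] [Fintype ι]
    [DecidableEq ι] {n N : ℕ} (hι : Fintype.card ι = N + 1) {w : Fin (n + 1) → ℕ}
    (hw : ∀ p : Fin n, 1 ≤ w p.succ) (v : Fin n → ι → K) :
    finrank K ((weightSpace K (ι → K) fun p => (w p : ℤ)).map
        (koszulFlattening K ι n (PiTensorProduct.tprod K v))) ≤
      (N + 1).choose (w 0) * ∏ p : Fin n, N.choose (w p.succ - 1) := by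
  rw [koszulFlattening_tprod]
  exact finrank_map_rowContraction_le ((finrank_pi K).trans hι) hw _

section BorderRank

variable {K : Type*} [Field K]

theorem exists_injective_of_mem_zariskiClosure {W X Y : Type*} [AddCommGroup W] [Module K W]
    [AddCommGroup X] [Module K X] [FiniteDimensional K X] [AddCommGroup Y] [Module K Y]
    (L : W →ₗ[K] X →ₗ[K] Y) {Z : Set W} {w : W} (hw : w ∈ zariskiClosure (K := K) Z)
    (hL : Function.Injective (L w)) : ∃ z ∈ Z, Function.Injective (L z) := by
  obtain ⟨g, hg⟩ := (L w).exists_leftInverse_of_injective (LinearMap.ker_eq_bot.2 hL)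
  let b := finBasis K X
  let p : MvPolynomial (Dual K W) K :=
    (Matrix.of fun i j => MvPolynomial.X (b.coord i ∘ₗ g ∘ₗ L.flip (b j))).det
  have hp (z : W) :
      MvPolynomial.eval (fun f : Dual K W => f z) p = LinearMap.det (g ∘ₗ L z) := by
    rw [← LinearMap.det_toMatrix b, RingHom.map_det]
    congr 1
    ext i j
    simp [LinearMap.toMatrix_apply]
  by_contra! hZ
  have hdet (z : W) (hz : z ∈ Z) : LinearMap.det (g ∘ₗ L z) = 0 :=
    LinearMap.det_eq_zero_iff_ker_ne_bot.2 fun h =>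
      hZ z hz (Function.Injective.of_comp (f := g) (LinearMap.ker_eq_bot.1 h))
  have h := hw p fun z hz => (hp z).trans (hdet z hz)
  rw [hp, hg, LinearMap.det_id] at h
  exact one_ne_zero h

theorem finrank_range_sum_le {ι X Y : Type*} [AddCommGroup X] [Module K X] [FiniteDimensional K X]
    [AddCommGroup Y] [Module K Y] (s : Finset ι) (f : ι → X →ₗ[K] Y) :
    finrank K (LinearMap.range (∑ i ∈ s, f i)) ≤ ∑ i ∈ s, finrank K (LinearMap.range (f i)) := by
  refine finrank_le_of_rank_le ((LinearMap.rank_finsetSum_le s f).trans_eq ?_)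
  rw [Nat.cast_sum]
  exact Finset.sum_congr rfl fun i _ => (finrank_eq_rank K _).symm

variable {d : ℕ} {V : Fin d → Type*} [∀ j, AddCommGroup (V j)] [∀ j, Module K (V j)]

theorem isSumOfDecomposables_tensorRank (hd : 1 ≤ d) (T : ⨂[K] j, V j) :
    IsSumOfDecomposables T (tensorRank T) :=
  Nat.sInf_mem (exists_isSumOfDecomposables hd T)

theorem borderRank_le_tensorRank (T : ⨂[K] j, V j) : borderRank T ≤ tensorRank T :=
  Nat.sInf_le fun _ hp => hp T (le_refl (tensorRank T))

theorem finrank_le_borderRank_mul {X Y : Type*} [AddCommGroup X] [Module K X]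
    [FiniteDimensional K X] [AddCommGroup Y] [Module K Y] (hd : 1 ≤ d)
    (L : (⨂[K] j, V j) →ₗ[K] X →ₗ[K] Y) {r : ℕ}
    (hr : ∀ v, finrank K (LinearMap.range (L (PiTensorProduct.tprod K v))) ≤ r)
    {T : ⨂[K] j, V j} (hT : Function.Injective (L T)) : finrank K X ≤ borderRank T * r := by
  obtain ⟨S, hS, hinj⟩ := exists_injective_of_mem_zariskiClosure L
    (Nat.sInf_mem (exists_mem_zariskiClosure T)) hT
  obtain ⟨v, hv⟩ := isSumOfDecomposables_tensorRank hd S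
  calc finrank K X = finrank K (LinearMap.range (L S)) := (LinearMap.finrank_range_of_inj hinj).symm
    _ = finrank K (LinearMap.range (∑ i, L (PiTensorProduct.tprod K (v i)))) := by
      rw [← map_sum, ← hv]
    _ ≤ ∑ i, finrank K (LinearMap.range (L (PiTensorProduct.tprod K (v i)))) :=
      finrank_range_sum_le _ _
    _ ≤ tensorRank S * r := by
      simpa using Finset.sum_le_card_nsmul Finset.univ _ r fun i _ => hr (v i)
    _ ≤ borderRank T * r := Nat.mul_le_mul_right r hS

end BorderRank

section Determinant

/-- The weight with no particle in row `0` and `n, …, 1` particles in the rows `1, …, n`: when the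
rows `n, …, 1` give one particle each, in this order, to row `0`, the giving row always holds more
particles than row `0`. -/
def flagWeight (n : ℕ) : Fin (n + 1) → ℕ :=
  Fin.cons 0 fun p => p.rev + 1

theorem prod_choose_mul_factorial (n : ℕ) :
    (∏ p : Fin (n + 1), (n + 1).choose (p.rev + 1)) * n ! =
      (n + 1) ^ n * ∏ p : Fin (n + 1), n.choose p.rev := by
  have hfact : ∏ p : Fin (n + 1), ((p.rev : ℕ) + 1) = (n + 1) * n ! := by
    rw [Fintype.prod_equiv Fin.revPerm _ (fun p => (p : ℕ) + 1) (by simp),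
      Fin.prod_univ_eq_prod_range (· + 1), Finset.prod_range_add_one_eq_factorial,
      Nat.factorial_succ]
  refine Nat.eq_of_mul_eq_mul_left n.succ_pos ?_
  calc (n + 1) * ((∏ p : Fin (n + 1), (n + 1).choose (p.rev + 1)) * n !)
      = ∏ p : Fin (n + 1), (n + 1).choose (p.rev + 1) * (p.rev + 1) := by
        rw [Finset.prod_mul_distrib, hfact, mul_left_comm]
    _ = ∏ p : Fin (n + 1), (n + 1) * n.choose p.rev :=
        Finset.prod_congr rfl fun p _ => (Nat.add_one_mul_choose_eq n p.rev).symm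
    _ = (n + 1) * ((n + 1) ^ n * ∏ p : Fin (n + 1), n.choose p.rev) := by
        rw [Finset.prod_mul_distrib, Fin.prod_const, pow_succ', mul_assoc]

theorem pow_le_borderRank_detTensor_mul_factorial (K : Type*) [Field K] [CharZero K] (n : ℕ) :
    (n + 1) ^ n ≤ borderRank (detTensor K (n + 1)) * n ! := by
  let V := Fin (n + 1) → K
  let X := weightSpace K V fun p => (flagWeight (n + 1) p : ℤ)
  let L := LinearMap.lcomp K _ X.subtype ∘ₗ koszulFlattening K (Fin (n + 1)) (n + 1)
  have hrank (v) : finrank K (LinearMap.range (L (PiTensorProduct.tprod K v))) ≤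
      ∏ p : Fin (n + 1), n.choose p.rev := by
    have hL : L (PiTensorProduct.tprod K v) =
        koszulFlattening K (Fin (n + 1)) (n + 1) (PiTensorProduct.tprod K v) ∘ₗ X.subtype := rfl
    rw [hL, LinearMap.range_comp, X.range_subtype]
    refine (finrank_map_koszulFlattening_tprod_le (Fintype.card_fin (n + 1))
      (w := flagWeight (n + 1)) (fun p => Nat.le_add_left 1 _) v).trans_eq ?_
    simp [flagWeight]
  have hinj : Function.Injective (L (detTensor K (n + 1))) := by
    refine (injective_iff_map_eq_zero _).2 fun x hx => Subtype.ext ?_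
    refine eq_zero_of_koszulFlattening_detTensor_eq_zero (fun p => ?_) x.2 hx
    simp [flagWeight]
  have hbound := finrank_le_borderRank_mul n.succ_pos L hrank hinj
  have hfinrank : finrank K X = ∏ p : Fin (n + 1), (n + 1).choose (p.rev + 1) := by
    rw [finrank_weightSpace, Fin.prod_univ_succ, finrank_fintype_fun_eq_card, Fintype.card_fin]
    simp only [flagWeight, Fin.cons_zero, Fin.cons_succ, Nat.choose_zero_right, one_mul]
  have hpos : 0 < ∏ p : Fin (n + 1), n.choose p.rev :=
    Finset.prod_pos fun p _ => Nat.choose_pos (Nat.lt_succ_iff.1 p.rev.2)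
  refine Nat.le_of_mul_le_mul_right ?_ hpos
  rw [← prod_choose_mul_factorial, mul_right_comm, ← hfinrank]
  exact Nat.mul_le_mul_right _ hbound

end Determinant

section Permanent

theorem sum_units_int_pow (K : Type*) [Ring K] (e : ℕ) :
    ∑ s : ℤˣ, ((s : ℤ) : K) ^ e = if Even e then 2 else 0 := by
  have huniv : (Finset.univ : Finset ℤˣ) = {1, -1} := rfl
  rw [huniv, Finset.sum_pair (by decide)]
  split_ifs with h
  · simpa [h.neg_pow] using one_add_one_eq_two
  · simp [(Nat.not_even_iff_odd.1 h).neg_pow]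

/-- The sign vector of length `m + 1` with first entry `1` and other entries `s`. -/
def signVector (K : Type*) [Ring K] {m : ℕ} (s : Fin m → ℤˣ) : Fin (m + 1) → K :=
  Fin.cons 1 fun k => ((s k : ℤ) : K)

theorem bijective_of_odd_card_fiber {m : ℕ} {r : Fin (m + 1) → Fin (m + 1)}
    (h : ∀ k : Fin m, Odd (Finset.univ.filter fun j => r j = k.succ).card) :
    Function.Bijective r := by
  have hsum : ∑ k, (Finset.univ.filter fun j => r j = k).card = m + 1 := by
    simpa using (Finset.card_eq_sum_card_fiberwise (f := r) (s := Finset.univ) (t := Finset.univ)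
      (by simp)).symm
  have hzero : Odd (Finset.univ.filter fun j => r j = 0).card := by
    have hmod : (∑ k : Fin m, (Finset.univ.filter fun j => r j = k.succ).card) % 2 = m % 2 := by
      rw [Finset.sum_nat_mod, Finset.sum_congr rfl fun k _ => Nat.odd_iff.1 (h k)]
      simp
    rw [Fin.sum_univ_succ] at hsum
    rw [Nat.odd_iff]
    omega
  refine Finite.surjective_iff_bijective.1 fun k => ?_
  have hk : Odd (Finset.univ.filter fun j => r j = k).card := Fin.cases hzero h k
  obtain ⟨j, hj⟩ := Finset.card_pos.1 hk.pos
  exact ⟨j, (Finset.mem_filter.1 hj).2⟩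

theorem prod_signVector_comp {K : Type*} [CommRing K] {m : ℕ} (s : Fin m → ℤˣ)
    (r : Fin (m + 1) → Fin (m + 1)) :
    ∏ j, signVector K s (r j) =
      ∏ k : Fin m, ((s k : ℤ) : K) ^ (Finset.univ.filter fun j => r j = k.succ).card := by
  calc ∏ j, signVector K s (r j)
      = ∏ k, signVector K s k ^ (Finset.univ.filter fun j => r j = k).card := by
        rw [← Finset.prod_fiberwise_of_maps_to (t := Finset.univ) (g := r) (by simp)]
        exact Finset.prod_congr rfl fun k _ =>
          Finset.prod_eq_pow_card fun j hj => by rw [(Finset.mem_filter.1 hj).2]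
    _ = _ := by simp [Fin.prod_univ_succ, signVector]

theorem sum_signVector_prod (K : Type*) [CommRing K] {m : ℕ} (r : Fin (m + 1) → Fin (m + 1)) :
    ∑ s : Fin m → ℤˣ, (∏ k, signVector K s k) * ∏ j, signVector K s (r j) =
      if Function.Bijective r then 2 ^ m else 0 := by
  let c (k : Fin m) := (Finset.univ.filter fun j => r j = k.succ).card
  have hsum : ∑ s : Fin m → ℤˣ, (∏ k, signVector K s k) * ∏ j, signVector K s (r j) =
      ∏ k, if Even (1 + c k) then 2 else 0 := by
    have hterm (s : Fin m → ℤˣ) : (∏ k, signVector K s k) * ∏ j, signVector K s (r j) =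
        ∏ k, ((s k : ℤ) : K) ^ (1 + c k) := by
      simp only [prod_signVector_comp, pow_add, pow_one, Finset.prod_mul_distrib, c]
      simp [signVector, Fin.prod_univ_succ]
    simp only [hterm, ← sum_units_int_pow, Finset.prod_univ_sum, Fintype.piFinset_univ]
  rw [hsum]
  split_ifs with hr
  · have hc (k : Fin m) : c k = 1 := by
      obtain ⟨j, hj, huniq⟩ := hr.existsUnique k.succ
      refine Finset.card_eq_one.2 ⟨j, Finset.ext fun i => ?_⟩
      simpa using ⟨huniq i, fun h => h ▸ hj⟩
    simp [hc]
  · obtain ⟨k, hk⟩ : ∃ k, ¬ Odd (c k) := by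
      by_contra! h
      exact hr (bijective_of_odd_card_fiber h)
    refine Finset.prod_eq_zero (Finset.mem_univ k) (if_neg ?_)
    rwa [add_comm, Nat.even_add_one, Nat.not_even_iff_odd]

/-- Glynn's formula. -/
theorem two_pow_smul_permTensor (K : Type*) [Field K] (m : ℕ) :
    (2 : K) ^ m • permTensor K (m + 1) = ∑ s : Fin m → ℤˣ,
      (∏ k, signVector K s k) • PiTensorProduct.tprod K fun _ : Fin (m + 1) => signVector K s := by
  have hexpand (v : Fin (m + 1) → K) : (PiTensorProduct.tprod K fun _ : Fin (m + 1) => v) =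
      ∑ r : Fin (m + 1) → Fin (m + 1), (∏ j, v (r j)) •
        PiTensorProduct.tprod K fun j => (Pi.single (r j) 1 : Fin (m + 1) → K) := by
    conv_lhs => rw [pi_eq_sum_univ' v]
    rw [MultilinearMap.map_sum]
    exact Finset.sum_congr rfl fun r _ => MultilinearMap.map_smul_univ _ _ _
  simp only [hexpand, Finset.smul_sum, smul_smul]
  rw [Finset.sum_comm]
  simp only [← Finset.sum_smul, sum_signVector_prod]
  rw [sum_perm_eq_sum_of_not_bijective _ fun r hr => by rw [if_neg hr, zero_smul], permTensor,
    Finset.smul_sum]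
  exact Finset.sum_congr rfl fun σ _ => by rw [if_pos σ.bijective]

theorem tensorRank_permTensor_le (K : Type*) [Field K] [NeZero (2 : K)] (m : ℕ) :
    tensorRank (permTensor K (m + 1)) ≤ 2 ^ m := by
  let e : Fin (2 ^ m) ≃ (Fin m → ℤˣ) := (Fintype.equivFinOfCardEq (by simp)).symm
  let c (i) : K := ((2 : K) ^ m)⁻¹ * ∏ k, signVector K (e i) k
  let v (i) : Fin (m + 1) → Fin (m + 1) → K := fun _ => signVector K (e i)
  refine Nat.sInf_le ⟨fun i => Function.update (v i) 0 (c i • v i 0), ?_⟩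
  simp only [MultilinearMap.map_update_smul, Function.update_eq_self]
  rw [← inv_smul_smul₀ (pow_ne_zero m (two_ne_zero (α := K))) (permTensor K (m + 1)),
    two_pow_smul_permTensor, Finset.smul_sum, ← e.sum_comp]
  simp only [smul_smul, c, v]

end Permanent

theorem two_pow_mul_factorial_lt {m : ℕ} (hm : 2 ≤ m) : 2 ^ m * m ! < (m + 1) ^ m := by
  induction m, hm using Nat.le_induction with
  | base => decide
  | succ m hm ih =>
    have bernoulli : (m + 1) ^ (m + 1) + (m + 1) * (m + 1) ^ m * 1 ≤ (m + 1 + 1) ^ (m + 1) :=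
      pow_add_mul_le_add_pow (Nat.zero_le _) (Nat.zero_le _) (m + 1)
    calc 2 ^ (m + 1) * (m + 1)! = 2 * (m + 1) * (2 ^ m * m !) := by
          rw [Nat.factorial_succ]; ring
      _ < 2 * (m + 1) * (m + 1) ^ m := Nat.mul_lt_mul_of_pos_left ih (by positivity)
      _ = (m + 1) ^ (m + 1) + (m + 1) * (m + 1) ^ m * 1 := by ring
      _ ≤ (m + 1 + 1) ^ (m + 1) := bernoulli

end TensorRank

end

theorem theorem4p2 (K : Type*) [Field K] [CharZero K] (n : ℕ) (hn : 1 ≤ n) :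
    ((n : ℚ) ^ (n - 1) / ((n - 1)! : ℕ) ≤ TensorRank.borderRank (TensorRank.detTensor K n)) ∧
    (3 ≤ n →
      TensorRank.tensorRank (TensorRank.permTensor K n) ≤ 2 ^ (n - 1) ∧
      (2 : ℚ) ^ (n - 1) < (n : ℚ) ^ (n - 1) / ((n - 1)! : ℕ) ∧
      TensorRank.borderRank (TensorRank.detTensor K n) ≤
        TensorRank.tensorRank (TensorRank.detTensor K n) ∧
      TensorRank.tensorRank (TensorRank.permTensor K n) <
        TensorRank.tensorRank (TensorRank.detTensor K n)) := by
  obtain ⟨m, rfl⟩ := Nat.exists_eq_add_of_le' hn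
  rw [Nat.add_sub_cancel]
  have hfac : (0 : ℚ) < (m ! : ℕ) := Nat.cast_pos.2 m.factorial_pos
  have hborder : ((m + 1 : ℕ) : ℚ) ^ m / (m ! : ℕ) ≤
      TensorRank.borderRank (TensorRank.detTensor K (m + 1)) := by
    rw [div_le_iff₀ hfac]
    exact_mod_cast TensorRank.pow_le_borderRank_detTensor_mul_factorial K m
  refine ⟨hborder, fun hm => ?_⟩
  have hperm := TensorRank.tensorRank_permTensor_le K m
  have hlt : (2 : ℚ) ^ m < ((m + 1 : ℕ) : ℚ) ^ m / (m ! : ℕ) := by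
    rw [lt_div_iff₀ hfac]
    exact_mod_cast TensorRank.two_pow_mul_factorial_lt (Nat.le_of_succ_le_succ hm)
  have hle := TensorRank.borderRank_le_tensorRank (TensorRank.detTensor K (m + 1))
  have hlt' : 2 ^ m < TensorRank.borderRank (TensorRank.detTensor K (m + 1)) := by
    exact_mod_cast hlt.trans_le hborder
  exact ⟨hperm, hlt, hle, hperm.trans_lt (hlt'.trans_le hle)⟩
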